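/- Let $m=(m_k)_{k\ge 0}$ be a bounded sequence of integers $m_k\ge 2$, let $G_m=\prod_{k\ge0}\mathbb{Z}/m_k$ be the corresponding bounded Vilenkin group, and let $\mu$ be its normalized Haar measure (the product of the uniform measures on $\mathbb{Z}/m_k$). Put $M_0=1$, $M_{k+1}=m_kM_k$, and write each $n\in\mathbb{N}=\{0,1,2,\dots\}$ as $n=\sum_k n_kM_k$ with $0\le n_k<m_k$. The Vilenkin functions are $$\psi_n(x)=\prod_{k}r_k(x)^{n_k},\qquad r_k(x)=\exp(2\pi i x_k/m_k).$$ Let $\mathcal F_n$ be the $\sigma$-algebra generated by the intervals $I_n(x)=\{y\in G_m: y_0=x_0,\dots,y_{n-1}=x_{n-1}\}$, $x\in G_m$. The martingale Hardy space $H_1$ consists of the complex-valued martingales $f=(f^{(n)})_{n\in\mathbb{N}}$ with respect to $(\mathcal F_n)$ for which $$\|f\|_{H_1}:=\Big\|\sup_{n}|f^{(n)}|\Big\|_{L_1(\mu)}<\infty .$$ A function $f\in L_1(\mu)$ is identified with the martingale $(E[f\mid\mathcal F_n])_n$. For a martingale $f$ put $\widehat f(i)=\lim_{k\to\infty}\int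 f^{(k)}\overline{\psi_i}\,d\mu$ and $S_nf=\sum_{k=0}^{n-1}\widehat f(k)\psi_k$; write $\|\cdot\|_1$ for the norm of $L_1(\mu)$. (a) There is an absolute constant $c$ (independent of $f$ and of $m$) such that for every $f\in H_1$ $$\sup_{n\ge 2}\frac{1}{n\log n}\sum_{k=1}^{n}\|S_kf\|_1\le c\,\|f\|_{H_1}.$$ (b) Let $\varphi:\{1,2,\dots\}\to[1,\infty)$ be nondecreasing with $$\limsup_{n\to\infty}\frac{\log n}{\varphi_n}=+\infty .$$ Then there is a function $f\in L_1(\mu)$ with $f\in H_1$ such that $$\sup_{n\ge 1}\frac{1}{n\varphi_n}\sum_{k=1}^{n}\|S_kf\|_1=\infty .$$ (c) In particular, there is a function $f\in L_1(\mu)$ with $f\in H_1$ such that $$\sup_{n\ge 1}\frac1n\sum_{k=1}^{n}\|S_kf\|_1=\infty .$$ -/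

import Mathlib

open MeasureTheory Filter
open scoped ENNReal NNReal

namespace Vilenkin

/-- The Vilenkin group `G_m`: the complete direct product of the cyclic groups `ℤ/m_k`. -/
abbrev VilenkinGroup (m : ℕ → ℕ) : Type := ∀ k, ZMod (m k)

/-- The normalized Haar measure on `G_m`: the product of the uniform probability measures
`μ_k({j}) = 1/m_k` on `ℤ/m_k`. -/
noncomputable def haar (m : ℕ → ℕ) [∀ k, NeZero (m k)] : Measure (VilenkinGroup m) :=
  Measure.infinitePi fun k => (PMF.uniformOfFintype (ZMod (m k))).toMeasure

/-- The generalized number system `M_0 = 1`, `M_{k+1} = m_k M_k`. -/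
def genM (m : ℕ → ℕ) : ℕ → ℕ
  | 0 => 1
  | k + 1 => m k * genM m k

/-- The `k`-th digit `n_k` of `n` in the expansion `n = ∑_k n_k M_k`, `0 ≤ n_k < m_k`. -/
def digit (m : ℕ → ℕ) (n k : ℕ) : ℕ := n / genM m k % m k

/-- The generalized Rademacher function `r_k(x) = exp(2πi x_k / m_k)`. -/
noncomputable def rademacher (m : ℕ → ℕ) (k : ℕ) (x : VilenkinGroup m) : ℂ :=
  Complex.exp (2 * Real.pi * Complex.I * ((x k).val : ℂ) / (m k : ℂ))

/-- The Vilenkin function `ψ_n = ∏_k r_k ^ {n_k}`. The product is finite because the digits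
`n_k` with `k ≥ n` vanish when all `m_k ≥ 2` (see `digit_eq_zero`). -/
noncomputable def psi (m : ℕ → ℕ) (n : ℕ) (x : VilenkinGroup m) : ℂ :=
  ∏ k ∈ Finset.range n, rademacher m k x ^ digit m n k

theorem lt_genM {m : ℕ → ℕ} (hm : ∀ k, 2 ≤ m k) (k : ℕ) : k < genM m k := by
  induction k with
  | zero => simp [genM]
  | succ k ih =>
    have h := hm k
    simp only [genM]
    nlinarith

theorem digit_eq_zero {m : ℕ → ℕ} (hm : ∀ k, 2 ≤ m k) {n k : ℕ} (h : n ≤ k) :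
    digit m n k = 0 := by
  simp [digit, Nat.div_eq_of_lt (lt_of_le_of_lt h (lt_genM hm k))]

/-- The interval `I_n(x) = {y : y_0 = x_0, …, y_{n-1} = x_{n-1}}`. -/
def interval (m : ℕ → ℕ) (n : ℕ) (x : VilenkinGroup m) : Set (VilenkinGroup m) :=
  {y | ∀ i < n, y i = x i}

theorem measurableSet_interval (m : ℕ → ℕ) (n : ℕ) (x : VilenkinGroup m) :
    MeasurableSet (interval m n x) := by
  have h : interval m n x = ⋂ i ∈ Finset.range n, (fun y : VilenkinGroup m => y i) ⁻¹' {x i} := by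
    ext y
    simp [interval]
  rw [h]
  exact Finset.measurableSet_biInter _ fun i _ => measurable_pi_apply i trivial

theorem interval_eq_iUnion (m : ℕ → ℕ) (n : ℕ) (x : VilenkinGroup m) :
    interval m n x = ⋃ a : ZMod (m n), interval m (n + 1) (Function.update x n a) := by
  ext y
  simp only [interval, Set.mem_ofPred_eq, Set.mem_iUnion]
  constructor
  · intro h
    refine ⟨y n, fun i hi => ?_⟩
    rcases eq_or_ne i n with rfl | hne
    · simp
    · rw [Function.update_of_ne hne]
      exact h i (by omega)
  · rintro ⟨a, h⟩ i hi
    have := h i (by omega)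
    rwa [Function.update_of_ne (by omega)] at this

/-- The filtration whose `n`-th σ-algebra is generated by the intervals `I_n(x)`, `x ∈ G_m`. -/
def filtration (m : ℕ → ℕ) [∀ k, NeZero (m k)] :
    Filtration ℕ (inferInstance : MeasurableSpace (VilenkinGroup m)) where
  seq n := MeasurableSpace.generateFrom (Set.range (interval m n))
  mono' := by
    refine monotone_nat_of_le_succ fun n => MeasurableSpace.generateFrom_le ?_
    rintro _ ⟨x, rfl⟩
    rw [interval_eq_iUnion]
    exact MeasurableSet.iUnion fun a => MeasurableSpace.measurableSet_generateFrom ⟨_, rfl⟩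
  le' n := by
    refine MeasurableSpace.generateFrom_le ?_
    rintro _ ⟨x, rfl⟩
    exact measurableSet_interval m n x

/-- The norm `‖f‖_{H_1} = ‖sup_n |f^{(n)}|‖_1` of a sequence of functions, as an extended
nonnegative real. -/
noncomputable def hardyNorm {m : ℕ → ℕ} [∀ k, NeZero (m k)] (f : ℕ → VilenkinGroup m → ℂ) :
    ℝ≥0∞ :=
  ∫⁻ x, ⨆ n, ‖f n x‖ₑ ∂(haar m)

/-- The martingale Hardy space `H_1(G_m)`. -/
def MemHardy {m : ℕ → ℕ} [∀ k, NeZero (m k)] (f : ℕ → VilenkinGroup m → ℂ) : Prop :=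
  Martingale f (filtration m) (haar m) ∧ hardyNorm f < ∞

/-- The regular martingale `(E_n g)_n` generated by a function `g`. -/
noncomputable def regularMartingale {m : ℕ → ℕ} [∀ k, NeZero (m k)] (g : VilenkinGroup m → ℂ) :
    ℕ → VilenkinGroup m → ℂ :=
  fun n => (haar m)[g | filtration m n]

/-- The Vilenkin–Fourier coefficients `lim_k ∫ f^{(k)} conj(ψ_i) dμ` of a martingale. For a
martingale the integrals are constant once `i < M_k`, so the limit exists; for the regular
martingale of `g ∈ L_1` it is `∫ g conj(ψ_i) dμ`. -/
noncomputable def coeff {m : ℕ → ℕ} [∀ k, NeZero (m k)] (f : ℕ → VilenkinGroup m → ℂ)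
    (i : ℕ) : ℂ :=
  limUnder atTop fun k => ∫ x, f k x * (starRingEnd ℂ) (psi m i x) ∂(haar m)

/-- The partial sum `S_n f = ∑_{k < n} f̂(k) ψ_k`. -/
noncomputable def partialSum {m : ℕ → ℕ} [∀ k, NeZero (m k)] (f : ℕ → VilenkinGroup m → ℂ)
    (n : ℕ) (x : VilenkinGroup m) : ℂ :=
  ∑ k ∈ Finset.range n, coeff f k * psi m k x

/-- `∑_{k=1}^n ‖S_k f‖_1`. -/
noncomputable def sumNorms {m : ℕ → ℕ} [∀ k, NeZero (m k)] (f : ℕ → VilenkinGroup m → ℂ)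
    (n : ℕ) : ℝ≥0∞ :=
  ∑ k ∈ Finset.Icc 1 n, eLpNorm (partialSum f k) 1 (haar m)

end Vilenkin

/-! ### Mixed-radix digits and pointwise identities for Dirichlet kernels. -/

namespace Vilenkin

/-! Everything rests on the recursion `D_{qM_i+r} = D_{qM_i} + r_i^q D_r` for the Dirichlet kernels
(`dirichlet_mul_add`) and on `D_{M_i} = M_i · 1_{I_i(0)}` (`dirichlet_genM`).

Upper bound: `S_n f` is the convolution of `f^{(n)}` with `D_n`, so `‖S_n f‖_1 ≤ ‖D_n‖_1 ‖f‖_{H_1}`.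
The norm of `D_{qM_i}` is that of a Dirichlet kernel on `ℤ/m_i`, at most `6 log(q+1)`. Since
`(q+1)(r+1) ≤ qM_i+r+1`, the recursion adds up the digits without loss and gives `‖D_n‖_1 ≤ 6
log(n+1)` for every `m` (`integral_norm_dirichlet_le`).

Sharpness: take `g = ∑ c_i (D_{M_{i+1}} - D_{M_i})` with `c_i ≥ 0` summable. The atoms have
`L_1`-norm at most 2, so `∑ c_i |a_i|` is an integrable majorant of the maximal function. For `k <
M_α`, `S_{M_α+k} g` is a partial sum of the series, bounded in `L_1`, plus `c_α r_α D_k`. The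
average of `‖D_k‖_1` over `k < M_α` is at least `(α-1)/(8B)` when `m ≤ B`
(`sum_integral_norm_dirichlet_ge`), so it remains to choose `c` with `c_α (α-1)/φ(2M_α)` unbounded.
-/

theorem genM_pos {m : ℕ → ℕ} (hm : ∀ k, 2 ≤ m k) (k : ℕ) : 0 < genM m k :=
  (Nat.zero_le k).trans_lt (lt_genM hm k)

theorem genM_dvd_genM (m : ℕ → ℕ) {i j : ℕ} (h : i ≤ j) : genM m i ∣ genM m j := by
  induction j, h using Nat.le_induction with
  | base => exact dvd_rfl
  | succ j _ ih => exact ih.mul_left _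

theorem genM_mono {m : ℕ → ℕ} (hm : ∀ k, 2 ≤ m k) : Monotone (genM m) := fun _ j h =>
  Nat.le_of_dvd (genM_pos hm j) (genM_dvd_genM m h)

theorem two_mul_genM_le {m : ℕ → ℕ} (hm : ∀ k, 2 ≤ m k) (k : ℕ) :
    2 * genM m k ≤ genM m (k + 1) :=
  Nat.mul_le_mul_right _ (hm k)

theorem digit_eq_zero_of_lt {m : ℕ → ℕ} {n k : ℕ} (h : n < genM m k) : digit m n k = 0 := by
  simp [digit, Nat.div_eq_of_lt h]

theorem digit_mul_add_self {m : ℕ → ℕ} {i q r : ℕ} (hq : q < m i) (hr : r < genM m i) :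
    digit m (q * genM m i + r) i = q := by
  have h : 0 < genM m i := by omega
  rw [digit, Nat.mul_comm, Nat.mul_add_div h, Nat.div_eq_of_lt hr, add_zero, Nat.mod_eq_of_lt hq]

theorem digit_mul_add_of_lt {m : ℕ → ℕ} (hm : ∀ k, 2 ≤ m k) {i k : ℕ} (q r : ℕ) (hk : k < i) :
    digit m (q * genM m i + r) k = digit m r k := by
  obtain ⟨c, hc⟩ := genM_dvd_genM m (Nat.succ_le_of_lt hk)
  have h : q * genM m i + r = genM m k * (m k * (q * c)) + r := by
    rw [hc]; simp only [genM]; ring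
  rw [digit, digit, h, Nat.mul_add_div (genM_pos hm k), Nat.mul_add_mod]

theorem psi_eq_prod {m : ℕ → ℕ} (hm : ∀ k, 2 ≤ m k) {n N : ℕ} (h : n < genM m N) (x : VilenkinGroup m) :
    psi m n x = ∏ k ∈ Finset.range N, rademacher m k x ^ digit m n k := by
  have h1 : ∀ k, k ∉ Finset.range n → rademacher m k x ^ digit m n k = 1 := fun k hk => by
    rw [digit_eq_zero hm (by simpa using hk), pow_zero]
  have h2 : ∀ k, k ∉ Finset.range N → rademacher m k x ^ digit m n k = 1 := fun k hk => by
    rw [digit_eq_zero_of_lt (h.trans_le (genM_mono hm (by simpa using hk))), pow_zero]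
  rw [psi]
  rcases le_total n N with hN | hN
  · exact Finset.prod_subset (Finset.range_mono hN) fun k _ hk => h1 k hk
  · exact (Finset.prod_subset (Finset.range_mono hN) fun k _ hk => h2 k hk).symm

theorem psi_congr {m : ℕ → ℕ} (hm : ∀ k, 2 ≤ m k) {n N : ℕ} (h : n < genM m N) {x y : VilenkinGroup m}
    (hxy : y ∈ interval m N x) : psi m n y = psi m n x := by
  rw [psi_eq_prod hm h, psi_eq_prod hm h]
  refine Finset.prod_congr rfl fun k hk => ?_
  rw [rademacher, rademacher, hxy k (Finset.mem_range.1 hk)]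

theorem psi_zero {m : ℕ → ℕ} (n : ℕ) : psi m n 0 = 1 := by
  simp [psi, rademacher]

theorem mem_interval_succ {m : ℕ → ℕ} {i : ℕ} {x y : VilenkinGroup m} :
    x ∈ interval m (i + 1) y ↔ x ∈ interval m i y ∧ x i = y i := by
  simp only [interval, Set.mem_ofPred_eq, Nat.lt_succ_iff_lt_or_eq]
  constructor
  · exact fun h => ⟨fun j hj => h j (.inl hj), h i (.inr rfl)⟩
  · rintro ⟨h, h'⟩ j (hj | rfl)
    exacts [h j hj, h']

theorem psi_mul_add {m : ℕ → ℕ} (hm : ∀ k, 2 ≤ m k) {i q r : ℕ} (hq : q < m i) (hr : r < genM m i)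
    (x : VilenkinGroup m) :
    psi m (q * genM m i + r) x = rademacher m i x ^ q * psi m r x := by
  have h : q * genM m i + r < genM m (i + 1) := by
    simp only [genM]; nlinarith
  rw [psi_eq_prod hm h, psi_eq_prod hm hr, Finset.prod_range_succ, digit_mul_add_self hq hr,
    mul_comm]
  congr 1
  exact Finset.prod_congr rfl fun k hk => by
    rw [digit_mul_add_of_lt hm _ _ (Finset.mem_range.1 hk)]

/-- The Vilenkin–Dirichlet kernel `D_n = ∑_{k < n} ψ_k`. -/
noncomputable def dirichlet (m : ℕ → ℕ) (n : ℕ) (x : VilenkinGroup m) : ℂ :=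
  ∑ k ∈ Finset.range n, psi m k x

theorem dirichlet_eq_of_mem_interval {m : ℕ → ℕ} (hm : ∀ k, 2 ≤ m k) {i r : ℕ} (hr : r ≤ genM m i)
    {x : VilenkinGroup m} (hx : x ∈ interval m i 0) : dirichlet m r x = r := by
  rw [dirichlet, Finset.sum_congr rfl fun k hk => by
    rw [psi_congr hm ((Finset.mem_range.1 hk).trans_le hr) hx, psi_zero]]
  simp

/-- Peels off the leading digit: the indices from `q M_i` on share it, so their characters have the
common factor `r_i^q`. -/
theorem dirichlet_mul_add {m : ℕ → ℕ} (hm : ∀ k, 2 ≤ m k) {i q r : ℕ} (hq : q < m i) (hr : r ≤ genM m i)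
    (x : VilenkinGroup m) :
    dirichlet m (q * genM m i + r) x =
      dirichlet m (q * genM m i) x + rademacher m i x ^ q * dirichlet m r x := by
  rw [dirichlet, Finset.sum_range_add, dirichlet, dirichlet, Finset.mul_sum]
  congr 1
  exact Finset.sum_congr rfl fun k hk =>
    psi_mul_add hm hq ((Finset.mem_range.1 hk).trans_le hr) x

theorem dirichlet_mul_genM {m : ℕ → ℕ} (hm : ∀ k, 2 ≤ m k) {i q : ℕ} (hq : q ≤ m i) (x : VilenkinGroup m) :
    dirichlet m (q * genM m i) x =
      (∑ u ∈ Finset.range q, rademacher m i x ^ u) * dirichlet m (genM m i) x := by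
  induction q with
  | zero => simp [dirichlet]
  | succ q ih =>
    rw [Nat.succ_mul, dirichlet_mul_add hm hq le_rfl, ih (by omega), Finset.sum_range_succ,
      add_mul]

/-! ### Rademacher functions as additive characters. -/

section

variable {m : ℕ → ℕ} [∀ k, NeZero (m k)]

theorem rademacher_eq_stdAddChar (k : ℕ) (x : VilenkinGroup m) :
    rademacher m k x = ZMod.stdAddChar (x k) := by
  rw [ZMod.stdAddChar_apply, ZMod.toCircle_apply, rademacher]

theorem norm_rademacher (k : ℕ) (x : VilenkinGroup m) : ‖rademacher m k x‖ = 1 := by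
  rw [rademacher_eq_stdAddChar, AddChar.norm_apply]

theorem rademacher_eq_one {k : ℕ} {x : VilenkinGroup m} (h : x k = 0) :
    rademacher m k x = 1 := by
  rw [rademacher_eq_stdAddChar, h, AddChar.map_zero_eq_one]

theorem rademacher_pow_modulus (k : ℕ) (x : VilenkinGroup m) :
    rademacher m k x ^ m k = 1 := by
  rw [rademacher_eq_stdAddChar, ← AddChar.map_nsmul_eq_pow]
  simp

theorem rademacher_ne_one {k : ℕ} {x : VilenkinGroup m} (h : x k ≠ 0) :
    rademacher m k x ≠ 1 := by
  rw [rademacher_eq_stdAddChar]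
  intro h1
  exact h (ZMod.injective_stdAddChar (by rw [h1, AddChar.map_zero_eq_one]))

theorem sum_rademacher_pow_modulus (k : ℕ) (x : VilenkinGroup m) :
    ∑ u ∈ Finset.range (m k), rademacher m k x ^ u = if x k = 0 then (m k : ℂ) else 0 := by
  split_ifs with h
  · simp [rademacher_eq_one h]
  · rw [geom_sum_eq (rademacher_ne_one h), rademacher_pow_modulus, sub_self, zero_div]

theorem rademacher_sub (k : ℕ) (x t : VilenkinGroup m) :
    rademacher m k (x - t) = rademacher m k x * (starRingEnd ℂ) (rademacher m k t) := by
  rw [rademacher_eq_stdAddChar, rademacher_eq_stdAddChar, rademacher_eq_stdAddChar, Pi.sub_apply,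
    sub_eq_add_neg, AddChar.map_add_eq_mul, AddChar.map_neg_eq_conj]

theorem norm_psi (n : ℕ) (x : VilenkinGroup m) : ‖psi m n x‖ = 1 := by
  simp [psi, norm_prod, norm_rademacher]

theorem psi_sub (n : ℕ) (x t : VilenkinGroup m) :
    psi m n (x - t) = psi m n x * (starRingEnd ℂ) (psi m n t) := by
  simp only [psi, rademacher_sub, mul_pow, Finset.prod_mul_distrib, map_prod, map_pow]

theorem norm_dirichlet_le (n : ℕ) (x : VilenkinGroup m) : ‖dirichlet m n x‖ ≤ n :=
  (norm_sum_le _ _).trans (by simp [norm_psi])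

/-- Each full digit contributes a complete character sum on `ℤ/m_i`, which vanishes unless `x_i =
0`. -/
theorem dirichlet_genM (hm : ∀ k, 2 ≤ m k) (i : ℕ) (x : VilenkinGroup m) :
    dirichlet m (genM m i) x = (interval m i 0).indicator (fun _ => (genM m i : ℂ)) x := by
  induction i with
  | zero => simp [dirichlet, genM, interval, psi]
  | succ i ih =>
    rw [genM, dirichlet_mul_genM hm le_rfl, ih, sum_rademacher_pow_modulus]
    by_cases h : x ∈ interval m i 0 <;> by_cases h' : x i = 0 <;>
      simp [Set.indicator, mem_interval_succ, h, h']

end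

/-! ### The discrete Dirichlet kernel on `ℤ/M`. -/

theorem sum_zmod_eq_sum_range {M : ℕ} [NeZero M] {R : Type*} [AddCommMonoid R] (F : ZMod M → R) :
    ∑ a, F a = ∑ i ∈ Finset.range M, F (i : ZMod M) := by
  refine Finset.sum_nbij' (fun a => a.val) (fun i => (i : ZMod M)) ?_ ?_ ?_ ?_ ?_
  · intro a _; simpa using ZMod.val_lt a
  · intro i _; simp
  · intro a _; simp
  · intro i hi; exact ZMod.val_cast_of_lt (Finset.mem_range.1 hi)
  · intro a _; simp

/-- Jordan's inequality `sin t ≥ 2t/π` on `[0, π/2]`; `b` plays the distance from `a` to the nearer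
of `0` and `M`. -/
theorem norm_stdAddChar_sub_one_ge {M : ℕ} [NeZero M] {a : ℕ} {b : ℝ} (hb0 : 0 ≤ b)
    (hb : 2 * b ≤ M) (hab : b = a ∨ b = M - a) :
    4 * b / M ≤ ‖(ZMod.stdAddChar (a : ZMod M) : ℂ) - 1‖ := by
  have hM : (0 : ℝ) < M := by exact_mod_cast NeZero.pos M
  have h := ZMod.stdAddChar_coe (N := M) (a : ℤ)
  push_cast at h
  have h1 : 2 * (Real.pi : ℂ) * Complex.I * a / M =
      Complex.I * ((2 * Real.pi * a / M : ℝ) : ℂ) := by push_cast; ring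
  rw [h, h1, Complex.norm_exp_I_mul_ofReal_sub_one]
  have h2 : Real.sin (2 * Real.pi * a / M / 2) = Real.sin (Real.pi * b / M) := by
    rcases hab with rfl | rfl
    · congr 1; ring
    · rw [← Real.sin_pi_sub]; congr 1; field_simp
  have h3 := Real.mul_le_sin (x := Real.pi * b / M) (by positivity) (by
    rw [div_le_div_iff₀ hM two_pos]; nlinarith [Real.pi_pos])
  have h4 : 2 / Real.pi * (Real.pi * b / M) = 2 * b / M := by
    field_simp
  rw [h4] at h3
  rw [h2, Real.norm_eq_abs]
  refine le_trans ?_ (le_abs_self _)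
  have : 4 * b / M = 2 * (2 * b / M) := by ring
  linarith

/-- Merges the trivial bound `q` with the bound `M/(2b)` from the closed form. The merged form is
one that telescopes against a logarithm. -/
theorem norm_geom_sum_stdAddChar_le {M : ℕ} [NeZero M] (q : ℕ) {a : ℕ} {b : ℝ} (hb0 : 0 ≤ b)
    (hb : 2 * b ≤ M) (hab : b = a ∨ b = M - a) :
    ‖∑ u ∈ Finset.range q, (ZMod.stdAddChar (a : ZMod M) : ℂ) ^ u‖ ≤
      M * (2 * q / (M + 2 * b * q)) := by
  have hM : (0 : ℝ) < M := by exact_mod_cast NeZero.pos M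
  set z : ℂ := ZMod.stdAddChar (a : ZMod M) with hz
  have hz1 : ‖z‖ = 1 := AddChar.norm_apply _ _
  set S := ∑ u ∈ Finset.range q, z ^ u with hS
  have h1 : ‖S‖ ≤ q := (norm_sum_le _ _).trans (by simp [hz1])
  have h2 : ‖S‖ * (4 * b / M) ≤ 2 := by
    calc ‖S‖ * (4 * b / M) ≤ ‖S‖ * ‖z - 1‖ := by
          gcongr
          exact norm_stdAddChar_sub_one_ge hb0 hb hab
      _ = ‖z ^ q - 1‖ := by rw [← norm_mul, geom_sum_mul]
      _ ≤ ‖z ^ q‖ + ‖(1 : ℂ)‖ := norm_sub_le _ _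
      _ = 2 := by rw [norm_pow, hz1, one_pow, norm_one]; norm_num
  have h3 : ‖S‖ * (2 * b) ≤ M := by
    have h : ‖S‖ * (4 * b / M) = ‖S‖ * (2 * b) * 2 / M := by ring
    rw [h, div_le_iff₀ hM] at h2
    linarith
  rw [← mul_div_assoc, le_div_iff₀ (by positivity)]
  have hq : (0 : ℝ) ≤ q := q.cast_nonneg
  nlinarith

/-- The discrete `L_1`-norm of a Dirichlet kernel on `ℤ/M` is at most logarithmic in the number
of its terms. -/
theorem sum_norm_geom_sum_stdAddChar_le {M : ℕ} [NeZero M] {q : ℕ} (hq : q ≤ M) :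
    ∑ a : ZMod M, ‖∑ u ∈ Finset.range q, (ZMod.stdAddChar a : ℂ) ^ u‖ ≤
      M * (6 * Real.log (q + 1)) := by
  rcases Nat.eq_zero_or_pos q with rfl | hq0
  · simp
  obtain ⟨N, rfl⟩ : ∃ N, M = N + 1 := Nat.exists_eq_succ_of_ne_zero (NeZero.ne M)
  have hq1 : (1 : ℝ) ≤ q := by exact_mod_cast hq0
  have hqM : (q : ℝ) ≤ (N + 1 : ℕ) := by exact_mod_cast hq
  obtain ⟨M, hM⟩ : ∃ M : ℝ, M = (N + 1 : ℕ) := ⟨_, rfl⟩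
  rw [← hM] at hqM ⊢
  have hM0 : 0 < M := by rw [hM]; positivity
  let h : ℝ → ℝ := fun b => M * (2 * q / (M + 2 * b * q))
  have h_nonneg : ∀ b, 0 ≤ b → 0 ≤ h b := fun b hb => by positivity
  -- This is `1 - p/p' ≤ log (p'/p)` for consecutive `p = M + 2iq`, `p' = p + 2q`.
  have h_le : ∀ i : ℕ, h (i + 1) ≤
      M * (Real.log (M + 2 * (i + 1 : ℕ) * q) - Real.log (M + 2 * i * q)) := fun i => by
    refine mul_le_mul_of_nonneg_left ?_ hM0.le
    have hp : 0 < M + 2 * (i : ℝ) * q := by positivity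
    have hp' : 0 < M + 2 * ((i : ℝ) + 1) * q := by positivity
    have := Real.one_sub_inv_le_log_of_pos (div_pos hp' hp)
    push_cast
    rw [← Real.log_div hp'.ne' hp.ne']
    refine le_trans (le_of_eq ?_) this
    field_simp
    ring
  -- The telescoped quotient is `(M + 2Nq)/M ≤ 1 + 2q ≤ (q+1)^2`.
  have h_sum : ∑ i ∈ Finset.range N, h (i + 1) ≤ M * (2 * Real.log (q + 1)) := by
    refine (Finset.sum_le_sum fun i _ => h_le i).trans ?_
    rw [← Finset.mul_sum, Finset.sum_range_sub (fun i : ℕ => Real.log (M + 2 * i * q))]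
    refine mul_le_mul_of_nonneg_left ?_ hM0.le
    have hN : (N : ℝ) ≤ M := by rw [hM]; push_cast; linarith
    rw [← Real.log_div (by positivity) (by push_cast; positivity)]
    have h2 : (2 : ℝ) * Real.log (q + 1) = Real.log ((q + 1) ^ 2) := by
      rw [Real.log_pow]; norm_num
    rw [h2]
    refine Real.log_le_log (by push_cast; positivity) ?_
    rw [div_le_iff₀ (by push_cast; positivity)]
    push_cast
    nlinarith [mul_le_mul_of_nonneg_right hN (by positivity : (0 : ℝ) ≤ q),
      mul_nonneg (sq_nonneg (q : ℝ)) hM0.le]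
  have h_refl : ∑ i ∈ Finset.range N, h (M - (i + 1)) = ∑ i ∈ Finset.range N, h (i + 1) := by
    rw [← Finset.sum_range_reflect]
    refine Finset.sum_congr rfl fun i hi => ?_
    have hi := Finset.mem_range.1 hi
    refine congrArg h ?_
    rw [hM, Nat.sub_sub, Nat.cast_sub (by omega)]
    push_cast
    ring
  -- The residue `0` contributes `q`, covered since `2 log 2 ≥ 1`. With the two halves of the
  -- nonzero residues this makes `2 + 2 + 2 = 6`.
  have h_one : (q : ℝ) ≤ M * (2 * Real.log (q + 1)) := by
    have h1 : Real.log 2 ≤ Real.log (q + 1) := Real.log_le_log two_pos (by linarith)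
    nlinarith [Real.log_two_gt_d9]
  rw [sum_zmod_eq_sum_range, Finset.sum_range_succ']
  have h_term : ∀ i ∈ Finset.range N,
      ‖∑ u ∈ Finset.range q, (ZMod.stdAddChar ((i + 1 : ℕ) : ZMod (N + 1)) : ℂ) ^ u‖ ≤
        h (i + 1) + h (M - (i + 1)) := fun i hi => by
    have hi : ((i + 1 : ℕ) : ℝ) ≤ N := by exact_mod_cast Finset.mem_range.1 hi
    push_cast at hi
    have hMN : M = N + 1 := by rw [hM]; push_cast; rfl
    have hi0 : (0 : ℝ) ≤ i := i.cast_nonneg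
    have hgs := fun b => norm_geom_sum_stdAddChar_le (M := N + 1) q (a := i + 1) (b := b)
    rw [← hM] at hgs
    rcases le_total (2 * ((i : ℝ) + 1)) M with hle | hle
    · refine (hgs (i + 1) (by positivity) hle (.inl (by push_cast; rfl))).trans ?_
      exact le_add_of_nonneg_right (h_nonneg _ (by linarith))
    · refine (hgs (M - (i + 1)) (by linarith) (by linarith) (.inr (by push_cast; rfl))).trans ?_
      exact le_add_of_nonneg_left (h_nonneg _ (by linarith))
  have h_zero : ‖∑ u ∈ Finset.range q, (ZMod.stdAddChar ((0 : ℕ) : ZMod (N + 1)) : ℂ) ^ u‖ = q := by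
    simp
  have := Finset.sum_le_sum h_term
  rw [Finset.sum_add_distrib, h_refl] at this
  rw [h_zero]
  linarith

/-! ### The filtration, Haar measure and translation invariance. -/

theorem finite_range_interval (m : ℕ → ℕ) [∀ k, NeZero (m k)] (n : ℕ) :
    (Set.range (interval m n)).Finite := by
  refine (Set.finite_range fun (p : ∀ i : Fin n, ZMod (m i)) =>
    {y : VilenkinGroup m | ∀ i : Fin n, y i = p i}).subset ?_
  rintro _ ⟨x, rfl⟩
  refine ⟨fun i => x i, ?_⟩
  ext y
  exact ⟨fun h i hi => h ⟨i, hi⟩, fun h i => h i i.2⟩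

theorem mem_interval_self (m : ℕ → ℕ) (n : ℕ) (x : VilenkinGroup m) : x ∈ interval m n x :=
  fun _ _ => rfl

theorem interval_antitone {m : ℕ → ℕ} (x : VilenkinGroup m) : Antitone (interval m · x) :=
  fun _ _ h _ hy i hi => hy i (hi.trans_le h)

section

variable {m : ℕ → ℕ} [∀ k, NeZero (m k)]

theorem mem_iff_of_measurableSet_filtration {n : ℕ} {s : Set (VilenkinGroup m)}
    (hs : MeasurableSet[filtration m n] s) {x y : VilenkinGroup m} (hxy : y ∈ interval m n x) :
    y ∈ s ↔ x ∈ s := by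
  induction s, hs using MeasurableSpace.generateFrom_induction with
  | hC t ht _ =>
    obtain ⟨z, rfl⟩ := ht
    exact forall₂_congr fun i hi => by rw [hxy i hi]
  | empty => simp
  | compl t _ ih => simp [ih]
  | iUnion t _ ih => simp [ih]

/-- Preimages are unions of rank-`n` intervals, of which there are only finitely many. -/
theorem measurable_filtration_of_congr {β : Type*} [MeasurableSpace β] {n : ℕ}
    {f : VilenkinGroup m → β} (hf : ∀ x y, y ∈ interval m n x → f y = f x) :
    Measurable[filtration m n] f := by
  intro s _
  have h : f ⁻¹' s = ⋃₀ (interval m n '' (f ⁻¹' s)) := by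
    ext x
    simp only [Set.mem_preimage, Set.sUnion_image, Set.mem_iUnion, exists_prop]
    exact ⟨fun hx => ⟨x, hx, mem_interval_self m n x⟩, fun ⟨y, hy, hxy⟩ => by rwa [hf y x hxy]⟩
  rw [h]
  refine MeasurableSet.sUnion (Set.Finite.countable <|
    (finite_range_interval m n).subset (Set.image_subset_range _ _)) ?_
  rintro _ ⟨x, -, rfl⟩
  exact MeasurableSpace.measurableSet_generateFrom ⟨x, rfl⟩

theorem measurable_psi_filtration (hm : ∀ k, 2 ≤ m k) {i N : ℕ} (h : i < genM m N) :
    Measurable[filtration m N] (psi m i) :=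
  measurable_filtration_of_congr fun _ _ => psi_congr hm h

theorem measurable_psi (hm : ∀ k, 2 ≤ m k) (i : ℕ) : Measurable (psi m i) :=
  (measurable_psi_filtration hm (lt_genM hm i)).mono ((filtration m).le i) le_rfl

theorem measurable_dirichlet_filtration (hm : ∀ k, 2 ≤ m k) {i N : ℕ} (h : i ≤ genM m N) :
    Measurable[filtration m N] (dirichlet m i) :=
  Finset.measurable_fun_sum _ fun _ hk =>
    measurable_psi_filtration hm ((Finset.mem_range.1 hk).trans_le h)

theorem measurable_dirichlet (hm : ∀ k, 2 ≤ m k) (i : ℕ) : Measurable (dirichlet m i) :=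
  Finset.measurable_fun_sum _ fun k _ => measurable_psi hm k

instance : IsProbabilityMeasure (haar m) := by
  unfold haar; infer_instance

theorem haar_interval (n : ℕ) (x : VilenkinGroup m) :
    haar m (interval m n x) = (genM m n : ℝ≥0∞)⁻¹ := by
  have h : interval m n x = (Finset.range n : Set ℕ).pi fun i => {x i} := by
    ext y; simp [interval]
  rw [h, haar, Measure.infinitePi_pi _ fun i _ => MeasurableSet.singleton _]
  simp only [PMF.toMeasure_apply_singleton _ _ (MeasurableSet.singleton _),
    PMF.uniformOfFintype_apply, ZMod.card]
  induction n with
  | zero => simp [genM]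
  | succ n ih =>
    rw [Finset.prod_range_succ, ih (by ext y; simp [interval]), genM, Nat.cast_mul, mul_comm,
      ENNReal.mul_inv (by simp) (by simp)]

theorem haar_real_interval (n : ℕ) (x : VilenkinGroup m) :
    (haar m).real (interval m n x) = (genM m n : ℝ)⁻¹ := by
  simp [Measure.real, haar_interval]

theorem measurePreserving_sub_haar (t : VilenkinGroup m) :
    MeasurePreserving (fun x => x - t) (haar m) (haar m) := by
  have h : ∀ i, Measurable fun a : ZMod (m i) => a - t i := fun i => measurable_from_top
  refine ⟨measurable_pi_lambda _ fun i => (h i).comp (measurable_pi_apply i), ?_⟩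
  have h' : ∀ i, (PMF.uniformOfFintype (ZMod (m i))).toMeasure.map (fun a => a - t i) =
      (PMF.uniformOfFintype (ZMod (m i))).toMeasure := fun i => by
    refine Measure.ext_of_singleton fun a => ?_
    have : (fun a => a - t i) ⁻¹' {a} = {a + t i} := by ext; simp [sub_eq_iff_eq_add]
    rw [Measure.map_apply (h i) (MeasurableSet.singleton _), this]
    simp [PMF.toMeasure_apply_singleton _ _ (MeasurableSet.singleton _)]
  have := Measure.infinitePi_map_pi
    (fun i => (PMF.uniformOfFintype (ZMod (m i))).toMeasure) h
  simp only [h'] at this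
  exact this

theorem integrable_of_norm_le {f : VilenkinGroup m → ℂ} (hf : Measurable f) {C : ℝ}
    (hC : ∀ x, ‖f x‖ ≤ C) : Integrable f (haar m) :=
  Integrable.of_bound hf.aestronglyMeasurable C (.of_forall hC)

theorem integrable_dirichlet (hm : ∀ k, 2 ≤ m k) (n : ℕ) : Integrable (dirichlet m n) (haar m) :=
  integrable_of_norm_le (measurable_dirichlet hm n) (norm_dirichlet_le n)

/-! ### Upper bound for the Lebesgue constants. -/

/-- The kernel lives on `I_i(0)` and is constant on each of its `m_i` subintervals of rank `i+1`, so
the integral is a finite average. -/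
theorem integral_norm_dirichlet_mul_genM (hm : ∀ k, 2 ≤ m k) {i q : ℕ} (hq : q ≤ m i) :
    ∫ x, ‖dirichlet m (q * genM m i) x‖ ∂(haar m) =
      (m i : ℝ)⁻¹ * ∑ a : ZMod (m i), ‖∑ u ∈ Finset.range q, (ZMod.stdAddChar a : ℂ) ^ u‖ := by
  have hM : (genM m i : ℝ) ≠ 0 := by exact_mod_cast (genM_pos hm i).ne'
  have h : ∀ x : VilenkinGroup m, ‖dirichlet m (q * genM m i) x‖ = ∑ a : ZMod (m i),
      (interval m (i + 1) (Function.update 0 i a)).indicator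
        (fun _ => genM m i * ‖∑ u ∈ Finset.range q, (ZMod.stdAddChar a : ℂ) ^ u‖) x := fun x => by
    have h0 : ∀ a : ZMod (m i), x ∈ interval m (i + 1) (Function.update 0 i a) ↔
        x ∈ interval m i 0 ∧ x i = a := fun a => by
      rw [mem_interval_succ, Function.update_self]
      exact and_congr_left' <| forall₂_congr fun j hj => by rw [Function.update_of_ne hj.ne]
    rw [dirichlet_mul_genM hm hq, dirichlet_genM hm, rademacher_eq_stdAddChar]
    by_cases hx : x ∈ interval m i 0
    · rw [Finset.sum_eq_single (x i)]
      · rw [Set.indicator_of_mem ((h0 _).2 ⟨hx, rfl⟩), Set.indicator_of_mem hx, norm_mul,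
          Complex.norm_natCast, mul_comm]
      · exact fun a _ ha => Set.indicator_of_notMem (fun h => ha ((h0 a).1 h).2.symm) _
      · simp
    · rw [Finset.sum_eq_zero fun a _ => Set.indicator_of_notMem (fun h => hx ((h0 a).1 h).1) _]
      simp [hx]
  simp only [h]
  rw [integral_finsetSum _ fun a _ =>
    (integrable_const _).indicator (measurableSet_interval m _ _), Finset.mul_sum]
  refine Finset.sum_congr rfl fun a _ => ?_
  rw [integral_indicator_const _ (measurableSet_interval m _ _), haar_real_interval, genM,
    Nat.cast_mul, smul_eq_mul, mul_inv]
  field_simp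

/-- The Lebesgue constants of a Vilenkin system grow at most logarithmically, uniformly in `m`. -/
theorem integral_norm_dirichlet_le (hm : ∀ k, 2 ≤ m k) (n : ℕ) :
    ∫ x, ‖dirichlet m n x‖ ∂(haar m) ≤ 6 * Real.log (n + 1) := by
  suffices h : ∀ N, ∀ n < genM m N, ∫ x, ‖dirichlet m n x‖ ∂(haar m) ≤ 6 * Real.log (n + 1) from
    h n n (lt_genM hm n)
  intro N
  induction N with
  | zero =>
    intro n hn
    obtain rfl : n = 0 := by simpa [genM] using hn
    simp [dirichlet]
  | succ N ih =>
    intro n hn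
    have hM := genM_pos hm N
    obtain ⟨q, r, hq, hr, rfl⟩ : ∃ q r, q < m N ∧ r < genM m N ∧ n = q * genM m N + r :=
      ⟨n / genM m N, n % genM m N, (Nat.div_lt_iff_lt_mul hM).2 hn, Nat.mod_lt _ hM,
        (Nat.div_add_mod' _ _).symm⟩
    have h1 : ∫ x, ‖dirichlet m (q * genM m N) x‖ ∂(haar m) ≤ 6 * Real.log (q + 1) := by
      rw [integral_norm_dirichlet_mul_genM hm hq.le, inv_mul_le_iff₀
        (by exact_mod_cast NeZero.pos (m N))]
      exact sum_norm_geom_sum_stdAddChar_le hq.le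
    have h2 := ih r hr
    have h3 : ∫ x, ‖dirichlet m (q * genM m N + r) x‖ ∂(haar m) ≤
        ∫ x, ‖dirichlet m (q * genM m N) x‖ ∂(haar m) + ∫ x, ‖dirichlet m r x‖ ∂(haar m) := by
      rw [← integral_add (integrable_dirichlet hm _).norm (integrable_dirichlet hm _).norm]
      refine integral_mono (integrable_dirichlet hm _).norm
        ((integrable_dirichlet hm _).norm.add (integrable_dirichlet hm _).norm) fun x => ?_
      rw [dirichlet_mul_add hm hq hr.le]
      refine (norm_add_le _ _).trans_eq ?_
      simp [norm_rademacher]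
    -- Because `r + 1 ≤ M_N`; this is why the constant 6 does not accumulate over the digits.
    have h4 : Real.log (q + 1) + Real.log (r + 1) ≤ Real.log ((q * genM m N + r : ℕ) + 1) := by
      rw [← Real.log_mul (by positivity) (by positivity)]
      refine Real.log_le_log (by positivity) ?_
      have : (q + 1) * (r + 1) ≤ q * genM m N + r + 1 := by nlinarith
      exact_mod_cast this
    linarith


/-! ### Partial sums as convolutions, and the bound (a). -/

/-- For `i < M_N` the factor `conj ψ_i` is `F_N`-measurable, so it pulls out of `E[· | F_N]`, which
sends `f k` to `f N`. -/
theorem integral_mul_conj_psi_eq (hm : ∀ k, 2 ≤ m k) {f : ℕ → VilenkinGroup m → ℂ}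
    (hf : Martingale f (filtration m) (haar m)) {i N k : ℕ} (hi : i < genM m N) (hk : N ≤ k) :
    ∫ x, f k x * (starRingEnd ℂ) (psi m i x) ∂(haar m) =
      ∫ x, f N x * (starRingEnd ℂ) (psi m i x) ∂(haar m) := by
  have hψ : StronglyMeasurable[filtration m N] fun x => (starRingEnd ℂ) (psi m i x) :=
    (Complex.continuous_conj.measurable.comp (measurable_psi_filtration hm hi)).stronglyMeasurable
  have hint : Integrable (fun x => (starRingEnd ℂ) (psi m i x) * f k x) (haar m) :=
    (hf.integrable k).bdd_mul (c := 1) (hψ.mono ((filtration m).le N)).aestronglyMeasurable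
      (.of_forall fun x => by simp [norm_psi])
  have h := condExp_bilin_of_stronglyMeasurable_left (ContinuousLinearMap.mul ℝ ℂ) hψ hint
    (hf.integrable k)
  simp only [ContinuousLinearMap.mul_apply'] at h
  simp only [mul_comm (f _ _)]
  rw [← integral_condExp ((filtration m).le N)]
  refine integral_congr_ae ?_
  filter_upwards [h, hf.condExp_ae_eq hk] with x h1 h2
  rw [h1, h2]

theorem coeff_eq_integral (hm : ∀ k, 2 ≤ m k) {f : ℕ → VilenkinGroup m → ℂ}
    (hf : Martingale f (filtration m) (haar m)) {i N : ℕ} (hi : i < genM m N) :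
    coeff f i = ∫ x, f N x * (starRingEnd ℂ) (psi m i x) ∂(haar m) := by
  refine Tendsto.limUnder_eq (tendsto_const_nhds.congr' ?_)
  filter_upwards [eventually_ge_atTop N] with k hk
  exact (integral_mul_conj_psi_eq hm hf hi hk).symm

theorem partialSum_eq_integral (hm : ∀ k, 2 ≤ m k) {f : ℕ → VilenkinGroup m → ℂ}
    (hf : Martingale f (filtration m) (haar m)) {n N : ℕ} (hn : n ≤ genM m N)
    (x : VilenkinGroup m) :
    partialSum f n x = ∫ t, f N t * dirichlet m n (x - t) ∂(haar m) := by
  simp only [dirichlet, psi_sub, Finset.mul_sum]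
  rw [integral_finsetSum, partialSum]
  · refine Finset.sum_congr rfl fun k hk => ?_
    rw [coeff_eq_integral hm hf ((Finset.mem_range.1 hk).trans_le hn), ← integral_mul_const]
    exact integral_congr_ae (.of_forall fun t => by ring)
  · intro k _
    refine (hf.integrable N).mul_bdd (c := 1) ?_ (.of_forall fun t => by simp [norm_psi])
    exact ((Complex.continuous_conj.measurable.comp
      (measurable_psi hm k)).const_mul _).aestronglyMeasurable

theorem measurable_sub_prod :
    Measurable fun p : VilenkinGroup m × VilenkinGroup m => p.1 - p.2 := by
  refine measurable_pi_lambda _ fun i => ?_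
  have h : Measurable fun p : ZMod (m i) × ZMod (m i) => p.1 - p.2 := measurable_of_finite _
  have h' : Measurable fun p : VilenkinGroup m × VilenkinGroup m => (p.1 i, p.2 i) :=
    ((measurable_pi_apply i).comp measurable_fst).prodMk
      ((measurable_pi_apply i).comp measurable_snd)
  exact h.comp h'

/-- Young's inequality by Tonelli and translation invariance. Level `n` of the martingale suffices
because `n < M_n`. -/
theorem eLpNorm_partialSum_le (hm : ∀ k, 2 ≤ m k) {f : ℕ → VilenkinGroup m → ℂ}
    (hf : Martingale f (filtration m) (haar m)) (n : ℕ) :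
    eLpNorm (partialSum f n) 1 (haar m) ≤
      ENNReal.ofReal (6 * Real.log (n + 1)) * hardyNorm f := by
  have hfm : Measurable (f n) := (hf.stronglyMeasurable n).measurable.mono
    ((filtration m).le n) le_rfl
  have hD := (measurable_dirichlet hm n).enorm
  have hL : ∫⁻ x, ‖dirichlet m n x‖ₑ ∂(haar m) ≤ ENNReal.ofReal (6 * Real.log (n + 1)) := by
    rw [← ofReal_integral_norm_eq_lintegral_enorm (integrable_dirichlet hm n)]
    exact ENNReal.ofReal_le_ofReal (integral_norm_dirichlet_le hm n)
  rw [eLpNorm_one_eq_lintegral_enorm]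
  calc ∫⁻ x, ‖partialSum f n x‖ₑ ∂(haar m)
      ≤ ∫⁻ x, ∫⁻ t, ‖f n t‖ₑ * ‖dirichlet m n (x - t)‖ₑ ∂(haar m) ∂(haar m) := by
        refine lintegral_mono fun x => ?_
        rw [partialSum_eq_integral hm hf (lt_genM hm n).le]
        refine (enorm_integral_le_lintegral_enorm _).trans_eq ?_
        simp only [enorm_mul]
    _ = ∫⁻ t, ∫⁻ x, ‖f n t‖ₑ * ‖dirichlet m n (x - t)‖ₑ ∂(haar m) ∂(haar m) :=
        lintegral_lintegral_swap ((hfm.comp measurable_snd).enorm.mul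
          (hD.comp measurable_sub_prod)).aemeasurable
    _ = ∫⁻ t, ‖f n t‖ₑ * ∫⁻ x, ‖dirichlet m n x‖ₑ ∂(haar m) ∂(haar m) := by
        refine lintegral_congr fun t => ?_
        rw [← (measurePreserving_sub_haar t).lintegral_comp hD]
        exact lintegral_const_mul _ (hD.comp (measurePreserving_sub_haar t).measurable)
    _ = (∫⁻ t, ‖f n t‖ₑ ∂(haar m)) * ∫⁻ x, ‖dirichlet m n x‖ₑ ∂(haar m) :=
        lintegral_mul_const _ hfm.enorm
    _ ≤ hardyNorm f * ENNReal.ofReal (6 * Real.log (n + 1)) :=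
        mul_le_mul' (lintegral_mono fun x => le_iSup (fun k => ‖f k x‖ₑ) n) hL
    _ = _ := mul_comm _ _

/-- The logarithmic means of the `L_1`-norms of partial sums are bounded on the martingale Hardy
space, with a constant that does not depend on the Vilenkin group. -/
theorem sumNorms_le (hm : ∀ k, 2 ≤ m k) {f : ℕ → VilenkinGroup m → ℂ}
    (hf : Martingale f (filtration m) (haar m)) {n : ℕ} (hn : 2 ≤ n) :
    sumNorms f n ≤ 12 * hardyNorm f * ENNReal.ofReal (n * Real.log n) := by
  have hn' : (2 : ℝ) ≤ n := by exact_mod_cast hn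
  -- `n + 1 ≤ n^2` for `n ≥ 2`; this doubles 6 to 12.
  have hlog : Real.log (n + 1) ≤ 2 * Real.log n := by
    rw [← Nat.cast_two, ← Real.log_pow]
    exact Real.log_le_log (by linarith) (by nlinarith)
  calc sumNorms f n
      ≤ ∑ k ∈ Finset.Icc 1 n, ENNReal.ofReal (12 * Real.log n) * hardyNorm f := by
        refine Finset.sum_le_sum fun k hk => (eLpNorm_partialSum_le hm hf k).trans ?_
        refine mul_le_mul_left (ENNReal.ofReal_le_ofReal ?_) _
        have hk : (k : ℝ) ≤ n := by exact_mod_cast (Finset.mem_Icc.1 hk).2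
        have := Real.log_le_log (by positivity : (0 : ℝ) < k + 1) (by linarith : (k : ℝ) + 1 ≤ n + 1)
        linarith
    _ = 12 * hardyNorm f * ENNReal.ofReal (n * Real.log n) := by
        rw [Finset.sum_const, Nat.card_Icc, nsmul_eq_mul, Nat.add_sub_cancel,
          ENNReal.ofReal_mul (by norm_num), ENNReal.ofReal_mul (by positivity),
          ENNReal.ofReal_natCast, ENNReal.ofReal_ofNat]
        ring

end

/-! ### Lower bound for the averaged Lebesgue constants. -/

/-- Off `I_i(0)` the kernel `D_{M_i}` vanishes, so `|D_k(x)|` repeats with period `M_i` in `k`. -/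
theorem sum_norm_dirichlet_mul_genM {m : ℕ → ℕ} [∀ k, NeZero (m k)] (hm : ∀ k, 2 ≤ m k) {i q : ℕ}
    (hq : q ≤ m i) {x : VilenkinGroup m} (hx : x ∉ interval m i 0) :
    ∑ k ∈ Finset.range (q * genM m i), ‖dirichlet m k x‖ =
      q * ∑ k ∈ Finset.range (genM m i), ‖dirichlet m k x‖ := by
  induction q with
  | zero => simp
  | succ q ih =>
    rw [Nat.succ_mul, Finset.sum_range_add, ih (by omega), Nat.cast_succ, add_mul, one_mul]
    congr 1
    refine Finset.sum_congr rfl fun k hk => ?_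
    rw [dirichlet_mul_add hm hq (Finset.mem_range.1 hk).le, dirichlet_mul_genM hm (by omega),
      dirichlet_genM hm, Set.indicator_of_notMem hx]
    simp [norm_rademacher]

theorem sum_norm_dirichlet_of_mem {m : ℕ → ℕ} (hm : ∀ k, 2 ≤ m k) {i : ℕ}
    {x : VilenkinGroup m} (hx : x ∈ interval m i 0) :
    ∑ k ∈ Finset.range (genM m i), ‖dirichlet m k x‖ = genM m i * (genM m i - 1 : ℝ) / 2 := by
  have h := Finset.sum_range_id_mul_two (genM m i)
  have h' : ((∑ k ∈ Finset.range (genM m i), k : ℕ) : ℝ) * 2 = genM m i * (genM m i - 1 : ℝ) := by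
    rw [← Nat.cast_pred (genM_pos hm i)]
    exact_mod_cast h
  rw [← h', mul_div_cancel_right₀ _ two_ne_zero, Nat.cast_sum]
  refine Finset.sum_congr rfl fun k hk => ?_
  rw [dirichlet_eq_of_mem_interval hm (Finset.mem_range.1 hk).le hx, Complex.norm_natCast]

section

variable {m : ℕ → ℕ} [∀ k, NeZero (m k)]

theorem integrable_sum_norm_dirichlet (hm : ∀ k, 2 ≤ m k) (n : ℕ) :
    Integrable (fun x => ∑ k ∈ Finset.range n, ‖dirichlet m k x‖) (haar m) :=
  integrable_finsetSum _ fun _ _ => (integrable_dirichlet hm _).norm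

/-- From `i` to `i+1`, periodicity multiplies the integral off `I_i(0)` by `m_i`, preserving the
average over indices. The new shell `I_i(0) \ I_{i+1}(0)`, where `D_k = k` for `k ≤ M_i`, adds at
least `M_i/8 ≥ M_{i+1}/(8B)`. -/
theorem setIntegral_sum_norm_dirichlet_ge (hm : ∀ k, 2 ≤ m k) {B : ℕ} (hB : ∀ k, m k ≤ B) (i : ℕ) :
    genM m i * ((i - 1 : ℝ) / (8 * B)) ≤
      ∫ x in (interval m i 0)ᶜ, ∑ k ∈ Finset.range (genM m i), ‖dirichlet m k x‖ ∂(haar m) := by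
  have hB0 : (0 : ℝ) < B := by exact_mod_cast (NeZero.pos (m 0)).trans_le (hB 0)
  have hpos : ∀ i, 0 ≤ ∫ x in (interval m i 0)ᶜ, ∑ k ∈ Finset.range (genM m i),
      ‖dirichlet m k x‖ ∂(haar m) := fun i =>
    integral_nonneg fun x => Finset.sum_nonneg fun _ _ => norm_nonneg _
  rcases Nat.eq_zero_or_pos i with rfl | hi
  · refine le_trans ?_ (hpos 0)
    refine mul_nonpos_of_nonneg_of_nonpos (by positivity) ?_
    exact div_nonpos_of_nonpos_of_nonneg (by norm_num) (by positivity)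
  induction i, hi using Nat.le_induction with
  | base => simpa using hpos 1
  | succ i hi ih =>
    have hM : (2 : ℝ) ≤ genM m i := by exact_mod_cast hi.trans_lt (lt_genM hm i)
    have hmi : (2 : ℝ) ≤ m i := by exact_mod_cast hm i
    have hmB : (m i : ℝ) ≤ B := by exact_mod_cast hB i
    have hsub : interval m (i + 1) 0 ⊆ interval m i 0 := interval_antitone 0 i.le_succ
    have hsplit : (interval m (i + 1) (0 : VilenkinGroup m))ᶜ =
        (interval m i 0)ᶜ ∪ (interval m i 0 \ interval m (i + 1) 0) := by
      ext x
      have := @hsub x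
      simp only [Set.mem_compl_iff, Set.mem_union, Set.mem_sdiff]
      tauto
    have hdisj : Disjoint (interval m i (0 : VilenkinGroup m))ᶜ
        (interval m i 0 \ interval m (i + 1) 0) :=
      disjoint_compl_left.mono_right Set.sdiff_subset
    have hmeas := measurableSet_interval m i 0
    have hmeas' := hmeas.diff (measurableSet_interval m (i + 1) 0)
    have hint := integrable_sum_norm_dirichlet hm (genM m (i + 1))
    rw [hsplit, setIntegral_union hdisj hmeas' hint.integrableOn hint.integrableOn]
    have h1 : ∫ x in (interval m i 0)ᶜ, ∑ k ∈ Finset.range (genM m (i + 1)),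
        ‖dirichlet m k x‖ ∂(haar m) = m i * ∫ x in (interval m i 0)ᶜ,
          ∑ k ∈ Finset.range (genM m i), ‖dirichlet m k x‖ ∂(haar m) := by
      rw [← integral_const_mul]
      exact setIntegral_congr_fun hmeas.compl fun x hx => sum_norm_dirichlet_mul_genM hm le_rfl hx
    have h2 : (1 / genM m i - 1 / (m i * genM m i)) * (genM m i * (genM m i - 1 : ℝ) / 2) ≤
        ∫ x in interval m i 0 \ interval m (i + 1) 0, ∑ k ∈ Finset.range (genM m (i + 1)),
        ‖dirichlet m k x‖ ∂(haar m) := by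
      have h3 : (haar m).real (interval m i 0 \ interval m (i + 1) 0) =
          1 / genM m i - 1 / (m i * genM m i) := by
        rw [measureReal_sdiff hsub (measurableSet_interval m (i + 1) 0), haar_real_interval,
          haar_real_interval, genM, Nat.cast_mul, one_div, one_div]
      rw [← h3, ← smul_eq_mul, ← setIntegral_const]
      refine setIntegral_mono_on integrableOn_const hint.integrableOn hmeas' fun x hx => ?_
      rw [← sum_norm_dirichlet_of_mem hm hx.1]
      exact Finset.sum_le_sum_of_subset_of_nonneg
        (Finset.range_mono (genM_mono hm i.le_succ)) fun _ _ _ => norm_nonneg _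
    -- Uses `1 - 1/m_i ≥ 1/2` and `M_i - 1 ≥ M_i/2`. The latter needs `i ≥ 1`, hence `i - 1` in the
    -- bound.
    have h4 : (genM m i : ℝ) / 8 ≤
        (1 / genM m i - 1 / (m i * genM m i)) * (genM m i * (genM m i - 1 : ℝ) / 2) := by
      have h5 : (1 / genM m i - 1 / (m i * genM m i)) * (genM m i * (genM m i - 1 : ℝ) / 2) =
          (1 - 1 / m i) * (genM m i - 1 : ℝ) / 2 := by
        field_simp
      have h6 : (1 : ℝ) / m i ≤ 1 / 2 := one_div_le_one_div_of_le two_pos hmi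
      rw [h5]
      nlinarith
    have h7 : (m i : ℝ) * genM m i * (1 / (8 * B)) ≤ genM m i / 8 := by
      rw [mul_one_div, div_le_div_iff₀ (by positivity) (by norm_num)]
      nlinarith
    have h8 : (m i : ℝ) * (genM m i * ((i - 1 : ℝ) / (8 * B))) ≤ m i *
        ∫ x in (interval m i 0)ᶜ, ∑ k ∈ Finset.range (genM m i), ‖dirichlet m k x‖ ∂(haar m) := by
      gcongr
    have h9 : ((genM m (i + 1) : ℕ) : ℝ) * (((i + 1 : ℕ) - 1 : ℝ) / (8 * B)) =
        (m i : ℝ) * (genM m i * ((i - 1 : ℝ) / (8 * B))) + m i * genM m i * (1 / (8 * B)) := by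
      rw [genM]; push_cast; ring
    rw [h1, h9]
    linarith

/-- The Lebesgue constants of a bounded Vilenkin system grow logarithmically on average. -/
theorem sum_integral_norm_dirichlet_ge (hm : ∀ k, 2 ≤ m k) {B : ℕ} (hB : ∀ k, m k ≤ B) (i : ℕ) :
    genM m i * ((i - 1 : ℝ) / (8 * B)) ≤
      ∑ k ∈ Finset.range (genM m i), ∫ x, ‖dirichlet m k x‖ ∂(haar m) := by
  rw [← integral_finsetSum _ fun _ _ => (integrable_dirichlet hm _).norm]
  exact (setIntegral_sum_norm_dirichlet_ge hm hB i).trans <|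
    setIntegral_le_integral (integrable_sum_norm_dirichlet hm _)
      (.of_forall fun x => Finset.sum_nonneg fun _ _ => norm_nonneg _)

end

/-! ### Fourier coefficients of `D_{M_i}`, atoms and their series. -/

theorem exists_le_digit_ne_zero {m : ℕ → ℕ} (hm : ∀ k, 2 ≤ m k) {i l : ℕ} (h : genM m i ≤ l) :
    ∃ k, i ≤ k ∧ digit m l k ≠ 0 := by
  have hex : ∃ k, l < genM m k := ⟨l, lt_genM hm l⟩
  have hspec := Nat.find_spec hex
  obtain ⟨k, hk⟩ : ∃ k, Nat.find hex = k + 1 := by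
    refine Nat.exists_eq_succ_of_ne_zero fun h0 => ?_
    rw [h0] at hspec
    have := genM_mono hm i.zero_le
    omega
  have hk' : genM m k ≤ l := not_lt.1 (Nat.find_min hex (by omega))
  rw [hk, genM] at hspec
  refine ⟨k, ?_, ?_⟩
  · by_contra! hlt
    have := genM_mono hm (Nat.succ_le_of_lt hlt)
    rw [Nat.succ_eq_add_one, genM] at this
    omega
  · rw [digit, Nat.mod_eq_of_lt ((Nat.div_lt_iff_lt_mul (genM_pos hm k)).2 hspec)]
    exact (Nat.div_pos hk' (genM_pos hm k)).ne'

theorem sum_range_ite_mul_psi {m : ℕ → ℕ} (n M : ℕ) (x : VilenkinGroup m) :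
    ∑ l ∈ Finset.range n, (if l < M then 1 else 0) * psi m l x = dirichlet m (min n M) x := by
  simp only [ite_mul, one_mul, zero_mul]
  rw [← Finset.sum_filter, dirichlet]
  congr 1
  ext l
  simp

section

variable {m : ℕ → ℕ} [∀ k, NeZero (m k)]

/-- A set in `F_n`, `n ≤ i`, contains or misses `I_i(0)` entirely, so `D_{M_i}` acts on it as a unit
mass at 0. -/
theorem setIntegral_dirichlet_genM (hm : ∀ k, 2 ≤ m k) {n i : ℕ} (hni : n ≤ i)
    {s : Set (VilenkinGroup m)} (hs : MeasurableSet[filtration m n] s) :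
    ∫ x in s, dirichlet m (genM m i) x ∂(haar m) = s.indicator 1 0 := by
  have hM : (genM m i : ℂ) ≠ 0 := by exact_mod_cast (genM_pos hm i).ne'
  have hI : ∀ x ∈ interval m i 0, x ∈ s ↔ 0 ∈ s := fun x hx =>
    mem_iff_of_measurableSet_filtration hs (interval_antitone 0 hni hx)
  simp only [dirichlet_genM hm]
  rw [setIntegral_indicator (measurableSet_interval m i 0), setIntegral_const]
  by_cases h : (0 : VilenkinGroup m) ∈ s
  · rw [Set.inter_eq_right.2 fun x hx => (hI x hx).2 h, haar_real_interval,
      Set.indicator_of_mem h]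
    simp [hM]
  · have : s ∩ interval m i 0 = ∅ := by
      ext x
      simp only [Set.mem_inter_iff, Set.mem_empty_iff_false, iff_false, not_and]
      exact fun hx hx' => h ((hI x hx').1 hx)
    simp [this, h]

theorem integral_norm_dirichlet_genM (hm : ∀ k, 2 ≤ m k) (i : ℕ) :
    ∫ x, ‖dirichlet m (genM m i) x‖ ∂(haar m) = 1 := by
  have h := integral_norm_dirichlet_mul_genM hm (i := i) (q := 1) (by linarith [hm i])
  rw [one_mul] at h
  rw [h]
  simp [ZMod.card]

theorem psi_single (hm : ∀ k, 2 ≤ m k) (l k : ℕ) :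
    psi m l (Pi.single k 1) = ZMod.stdAddChar (digit m l k : ZMod (m k)) := by
  have h : l < genM m (max l k + 1) := (lt_genM hm l).trans_le (genM_mono hm (by omega))
  rw [psi_eq_prod hm h, Finset.prod_eq_single k]
  · rw [rademacher_eq_stdAddChar, Pi.single_eq_same, ← AddChar.map_nsmul_eq_pow, nsmul_one]
  · intro j _ hj
    rw [rademacher_eq_one (Pi.single_eq_of_ne hj _), one_pow]
  · intro hk
    exact absurd (Finset.mem_range.2 (by omega)) hk

theorem integral_dirichlet_genM_mul_conj_psi (hm : ∀ k, 2 ≤ m k) (i l : ℕ) :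
    ∫ x, dirichlet m (genM m i) x * (starRingEnd ℂ) (psi m l x) ∂(haar m) =
      if l < genM m i then 1 else 0 := by
  split_ifs with h
  · have h1 : ∀ x : VilenkinGroup m, dirichlet m (genM m i) x * (starRingEnd ℂ) (psi m l x) =
        dirichlet m (genM m i) x := fun x => by
      rw [dirichlet_genM hm]
      by_cases hx : x ∈ interval m i 0
      · rw [psi_congr hm h hx, psi_zero, map_one, mul_one]
      · simp [hx]
    simp only [h1]
    have := setIntegral_dirichlet_genM hm (Nat.zero_le i) (s := Set.univ) MeasurableSet.univ
    simpa using this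
  -- Translation by the unit vector at `k ≥ i` fixes `D_{M_i}` but multiplies the integrand by
  -- `ψ_l(t) ≠ 1`; invariance of the integral forces it to be 0.
  · obtain ⟨k, hik, hk⟩ := exists_le_digit_ne_zero hm (not_lt.1 h)
    set F : VilenkinGroup m → ℂ :=
      fun x => dirichlet m (genM m i) x * (starRingEnd ℂ) (psi m l x) with hF
    have hFm : Measurable F := (measurable_dirichlet hm _).mul
      (Complex.continuous_conj.measurable.comp (measurable_psi hm l))
    let t : VilenkinGroup m := Pi.single k 1
    have ht : ∀ j < i, t j = 0 := fun j hj => Pi.single_eq_of_ne (by omega) _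
    have hψ : psi m l t ≠ 1 := by
      have hlt : digit m l k < m k := Nat.mod_lt _ (NeZero.pos _)
      rw [psi_single hm, ← AddChar.map_zero_eq_one (ZMod.stdAddChar (N := m k))]
      refine fun h => hk ?_
      have := ZMod.injective_stdAddChar h
      rw [ZMod.natCast_eq_zero_iff] at this
      exact Nat.eq_zero_of_dvd_of_lt this hlt
    have h1 : ∀ x, F (x - t) = F x * psi m l t := fun x => by
      have hmem : x - t ∈ interval m i 0 ↔ x ∈ interval m i 0 :=
        forall₂_congr fun j hj => by rw [Pi.sub_apply, ht j hj, sub_zero]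
      have hD : dirichlet m (genM m i) (x - t) = dirichlet m (genM m i) x := by
        rw [dirichlet_genM hm, dirichlet_genM hm]
        by_cases hx : x ∈ interval m i 0
        · rw [Set.indicator_of_mem hx, Set.indicator_of_mem (hmem.2 hx)]
        · rw [Set.indicator_of_notMem hx, Set.indicator_of_notMem (mt hmem.1 hx)]
      rw [hF]
      simp only [hD, psi_sub, map_mul, Complex.conj_conj, mul_assoc]
    have h2 : ∫ x, F (x - t) ∂(haar m) = ∫ x, F x ∂(haar m) := by
      have hp := measurePreserving_sub_haar t
      conv_rhs => rw [← hp.map_eq]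
      exact (integral_map hp.measurable.aemeasurable hFm.aestronglyMeasurable).symm
    simp only [h1] at h2
    rw [integral_mul_const] at h2
    by_contra h3
    exact hψ (mul_left_cancel₀ h3 (h2.trans (mul_one _).symm))

/-- The atom `D_{M_{i+1}} - D_{M_i}` of the martingale Hardy space. -/
noncomputable def atom (m : ℕ → ℕ) (i : ℕ) (x : VilenkinGroup m) : ℂ :=
  dirichlet m (genM m (i + 1)) x - dirichlet m (genM m i) x

theorem integrable_atom (hm : ∀ k, 2 ≤ m k) (i : ℕ) : Integrable (atom m i) (haar m) :=
  (integrable_dirichlet hm _).sub (integrable_dirichlet hm _)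

theorem measurable_atom (hm : ∀ k, 2 ≤ m k) (i : ℕ) :
    Measurable[filtration m (i + 1)] (atom m i) :=
  (measurable_dirichlet_filtration hm le_rfl).sub
    (measurable_dirichlet_filtration hm (genM_mono hm i.le_succ))

theorem integral_norm_atom_le (hm : ∀ k, 2 ≤ m k) (i : ℕ) :
    ∫ x, ‖atom m i x‖ ∂(haar m) ≤ 2 := by
  have h := integral_mono (integrable_atom hm i).norm
    ((integrable_dirichlet hm (genM m (i + 1))).norm.add (integrable_dirichlet hm (genM m i)).norm)
    fun x => norm_sub_le _ _
  refine h.trans_eq ?_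
  rw [integral_add' (integrable_dirichlet hm _).norm (integrable_dirichlet hm _).norm,
    integral_norm_dirichlet_genM hm, integral_norm_dirichlet_genM hm]
  norm_num

theorem setIntegral_atom_eq_zero (hm : ∀ k, 2 ≤ m k) {n i : ℕ} (hni : n ≤ i)
    {s : Set (VilenkinGroup m)} (hs : MeasurableSet[filtration m n] s) :
    ∫ x in s, atom m i x ∂(haar m) = 0 := by
  simp only [atom]
  rw [integral_sub (integrable_dirichlet hm _).integrableOn
    (integrable_dirichlet hm _).integrableOn, setIntegral_dirichlet_genM hm hni hs,
    setIntegral_dirichlet_genM hm (hni.trans i.le_succ) hs, sub_self]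

/-- The series `∑ c_i (D_{M_{i+1}} - D_{M_i})`. -/
noncomputable def atomSeries (m : ℕ → ℕ) (c : ℕ → ℝ) (x : VilenkinGroup m) : ℂ :=
  ∑' i, c i * atom m i x

/-- The partial sums of `atomSeries`. -/
noncomputable def atomSum (m : ℕ → ℕ) (c : ℕ → ℝ) (n : ℕ) (x : VilenkinGroup m) : ℂ :=
  ∑ i ∈ Finset.range n, c i * atom m i x

theorem integrable_mul_atom (hm : ∀ k, 2 ≤ m k) (c : ℕ → ℝ) (i : ℕ) :
    Integrable (fun x => c i * atom m i x) (haar m) :=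
  (integrable_atom hm i).const_mul _

theorem integrable_atomSum (hm : ∀ k, 2 ≤ m k) (c : ℕ → ℝ) (n : ℕ) :
    Integrable (atomSum m c n) (haar m) :=
  integrable_finsetSum _ fun i _ => integrable_mul_atom hm c i

theorem integral_norm_mul_atom_le (hm : ∀ k, 2 ≤ m k) {c : ℕ → ℝ} (hc0 : ∀ i, 0 ≤ c i) (i : ℕ) :
    ∫ x, ‖c i * atom m i x‖ ∂(haar m) ≤ c i * 2 := by
  simp only [norm_mul, Complex.norm_real, Real.norm_of_nonneg (hc0 i)]
  rw [integral_const_mul]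
  exact mul_le_mul_of_nonneg_left (integral_norm_atom_le hm i) (hc0 i)

/-- A single majorant for the series and for all its partial sums, giving both integrability and the
Hardy norm. -/
theorem lintegral_tsum_enorm_atom_lt_top (hm : ∀ k, 2 ≤ m k) {c : ℕ → ℝ} (hc0 : ∀ i, 0 ≤ c i)
    (hc : Summable c) : ∫⁻ x, ∑' i, ‖c i * atom m i x‖ₑ ∂(haar m) < ∞ := by
  rw [lintegral_tsum fun i => (integrable_mul_atom hm c i).aestronglyMeasurable.enorm]
  have h : ∀ i, ∫⁻ x, ‖c i * atom m i x‖ₑ ∂(haar m) ≤ ENNReal.ofReal (c i * 2) := fun i => by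
    rw [← ofReal_integral_norm_eq_lintegral_enorm (integrable_mul_atom hm c i)]
    exact ENNReal.ofReal_le_ofReal (integral_norm_mul_atom_le hm hc0 i)
  refine (ENNReal.tsum_le_tsum h).trans_lt ?_
  exact (hc.mul_right 2).tsum_ofReal_lt_top

theorem integrable_atomSeries (hm : ∀ k, 2 ≤ m k) {c : ℕ → ℝ} (hc0 : ∀ i, 0 ≤ c i)
    (hc : Summable c) : Integrable (atomSeries m c) (haar m) := by
  refine ⟨?_, ?_⟩
  · exact AEMeasurable.aestronglyMeasurable <| AEMeasurable.tsum fun i =>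
      (integrable_mul_atom hm c i).aemeasurable
  · exact (lintegral_mono fun x => enorm_tsum_le_tsum_enorm).trans_lt
      (lintegral_tsum_enorm_atom_lt_top hm hc0 hc)

/-- Atoms with `i ≥ n` have mean zero on every set of `F_n`; those with `i < n` are
`F_n`-measurable. -/
theorem regularMartingale_atomSeries (hm : ∀ k, 2 ≤ m k) {c : ℕ → ℝ} (hc0 : ∀ i, 0 ≤ c i)
    (hc : Summable c) (n : ℕ) :
    regularMartingale (atomSeries m c) n =ᵐ[haar m] atomSum m c n := by
  refine (ae_eq_condExp_of_forall_setIntegral_eq ((filtration m).le n)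
    (integrable_atomSeries hm hc0 hc) (fun s _ _ => (integrable_atomSum hm c n).integrableOn)
    (fun s hs _ => ?_) ?_).symm
  · have hsum : Summable fun i => ∫ x in s, ‖c i * atom m i x‖ ∂(haar m) :=
      (hc.mul_right 2).of_nonneg_of_le (fun i => integral_nonneg fun x => norm_nonneg _) fun i =>
        (setIntegral_le_integral (integrable_mul_atom hm c i).norm
          (.of_forall fun x => norm_nonneg _)).trans (integral_norm_mul_atom_le hm hc0 i)
    have h := hasSum_integral_of_summable_integral_norm
      (fun i => (integrable_mul_atom hm c i).integrableOn (s := s)) hsum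
    simp only [atomSeries, atomSum]
    rw [← h.tsum_eq, integral_finsetSum _ fun i _ => (integrable_mul_atom hm c i).integrableOn]
    refine (tsum_eq_sum fun i hi => ?_).symm
    rw [integral_const_mul, setIntegral_atom_eq_zero hm (by simpa using hi) hs, mul_zero]
  · refine Measurable.stronglyMeasurable ?_ |>.aestronglyMeasurable
    exact Finset.measurable_fun_sum _ fun i hi => ((measurable_atom hm i).mono
      ((filtration m).mono (Nat.succ_le_of_lt (Finset.mem_range.1 hi))) le_rfl).const_mul _

theorem memHardy_atomSeries (hm : ∀ k, 2 ≤ m k) {c : ℕ → ℝ} (hc0 : ∀ i, 0 ≤ c i)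
    (hc : Summable c) : MemHardy (regularMartingale (atomSeries m c)) := by
  refine ⟨martingale_condExp _ _ _, ?_⟩
  refine (lintegral_mono_ae ?_).trans_lt (lintegral_tsum_enorm_atom_lt_top hm hc0 hc)
  filter_upwards [ae_all_iff.2 (regularMartingale_atomSeries hm hc0 hc)] with x hx
  refine iSup_le fun n => ?_
  rw [hx, atomSum]
  exact (enorm_sum_le _ _).trans (ENNReal.sum_le_tsum _)

/-- The coefficients of atom `i` are 1 on `[M_i, M_{i+1})` and 0 elsewhere. Atoms below `α` are thus
complete, and atom `α` is cut to `D_{M_α+k} - D_{M_α} = r_α D_k`. -/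
theorem partialSum_atomSeries (hm : ∀ k, 2 ≤ m k) {c : ℕ → ℝ} (hc0 : ∀ i, 0 ≤ c i)
    (hc : Summable c) {α k : ℕ} (hk : k < genM m α) (x : VilenkinGroup m) :
    partialSum (regularMartingale (atomSeries m c)) (genM m α + k) x =
      atomSum m c α x + c α * (rademacher m α x * dirichlet m k x) := by
  have hM : genM m α + k < genM m (α + 1) := by
    have := two_mul_genM_le hm α
    omega
  have hcoeff : ∀ l ∈ Finset.range (genM m α + k),
      coeff (regularMartingale (atomSeries m c)) l * psi m l x =
        ∑ i ∈ Finset.range (α + 1), c i * (((if l < genM m (i + 1) then 1 else 0) * psi m l x) -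
          (if l < genM m i then 1 else 0) * psi m l x) := fun l hl => by
    have hint : ∀ j, Integrable (fun t => dirichlet m (genM m j) t *
        (starRingEnd ℂ) (psi m l t)) (haar m) := fun j =>
      (integrable_dirichlet hm _).mul_bdd (c := 1) (Complex.continuous_conj.measurable.comp
        (measurable_psi hm l)).aestronglyMeasurable (.of_forall fun t => by simp [norm_psi])
    rw [coeff_eq_integral hm (memHardy_atomSeries hm hc0 hc).1
      ((Finset.mem_range.1 hl).trans hM)]
    have h1 : ∫ t, regularMartingale (atomSeries m c) (α + 1) t *
        (starRingEnd ℂ) (psi m l t) ∂(haar m) = ∫ t, ∑ i ∈ Finset.range (α + 1),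
          c i * (dirichlet m (genM m (i + 1)) t * (starRingEnd ℂ) (psi m l t) -
            dirichlet m (genM m i) t * (starRingEnd ℂ) (psi m l t)) ∂(haar m) := by
      refine integral_congr_ae ?_
      filter_upwards [regularMartingale_atomSeries hm hc0 hc (α + 1)] with t ht
      rw [ht, atomSum, Finset.sum_mul]
      exact Finset.sum_congr rfl fun i _ => by rw [atom]; ring
    have h2 : ∀ i, Integrable (fun t => c i * (dirichlet m (genM m (i + 1)) t *
        (starRingEnd ℂ) (psi m l t) - dirichlet m (genM m i) t *
          (starRingEnd ℂ) (psi m l t))) (haar m) := fun i =>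
      ((hint _).sub (hint _)).const_mul _
    rw [h1, integral_finsetSum _ fun i _ => h2 i, Finset.sum_mul]
    refine Finset.sum_congr rfl fun i _ => ?_
    rw [integral_const_mul, integral_sub (hint _) (hint _),
      integral_dirichlet_genM_mul_conj_psi hm, integral_dirichlet_genM_mul_conj_psi hm]
    ring
  rw [partialSum, Finset.sum_congr rfl hcoeff, Finset.sum_comm]
  simp only [← Finset.mul_sum, Finset.sum_sub_distrib, sum_range_ite_mul_psi]
  rw [Finset.sum_range_succ, min_eq_left hM.le, min_eq_right (Nat.le_add_right _ _), atomSum]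
  congr 1
  · refine Finset.sum_congr rfl fun i hi => ?_
    have hi := Finset.mem_range.1 hi
    rw [min_eq_right ((genM_mono hm (Nat.succ_le_of_lt hi)).trans (Nat.le_add_right _ _)),
      min_eq_right ((genM_mono hm hi.le).trans (Nat.le_add_right _ _)), atom]
  · have h := dirichlet_mul_add hm (i := α) (q := 1) (hm α) hk.le x
    rw [one_mul, pow_one] at h
    rw [h, add_sub_cancel_left]

end

/-! ### Choice of the coefficients. -/

theorem genM_le_pow {m : ℕ → ℕ} {B : ℕ} (hB : ∀ k, m k ≤ B) (N : ℕ) : genM m N ≤ B ^ N := by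
  induction N with
  | zero => simp [genM]
  | succ N ih =>
    rw [genM, pow_succ, mul_comm]
    exact Nat.mul_le_mul ih (hB N)

/-- Weights `2^{-j}` on a subsequence along which `β > 4^j`, and 0 elsewhere. -/
theorem exists_summable_mul_unbounded {β : ℕ → ℝ} (h : ∀ C, ∃ᶠ i in atTop, C < β i) :
    ∃ c : ℕ → ℝ, (∀ i, 0 ≤ c i) ∧ Summable c ∧ ∀ C, ∃ i, C < c i * β i := by
  obtain ⟨a, ha, hβ⟩ := extraction_forall_of_frequently fun n : ℕ => h (4 ^ n)
  have hext : ∀ j, Function.extend a (fun j => (1 / 2 : ℝ) ^ j) 0 (a j) = (1 / 2) ^ j := fun j =>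
    ha.injective.extend_apply _ _ _
  refine ⟨Function.extend a (fun j => (1 / 2 : ℝ) ^ j) 0, fun i => ?_, ?_, fun C => ?_⟩
  · by_cases hi : ∃ j, a j = i
    · obtain ⟨j, rfl⟩ := hi
      rw [hext]; positivity
    · rw [Function.extend_apply' _ _ _ hi, Pi.zero_apply]
  · rw [← ha.injective.summable_iff fun i hi => by
      rw [Function.extend_apply' _ _ _ hi, Pi.zero_apply]]
    exact summable_geometric_two.congr fun j => (hext j).symm
  · obtain ⟨j, hj⟩ := pow_unbounded_of_one_lt C (one_lt_two (α := ℝ))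
    refine ⟨a j, hj.trans ?_⟩
    rw [hext]
    calc (2 : ℝ) ^ j = (1 / 2) ^ j * 4 ^ j := by rw [← mul_pow]; norm_num
      _ < _ := mul_lt_mul_of_pos_left (hβ j) (by positivity)

/-- If `M_{i+1} ≤ n < M_{i+2}`, then `φ(2M_i) ≤ φ(n)` and `log n ≤ (i+2) log B`, so passing from `n`
to `2M_i` costs only constants. -/
theorem frequently_lt_div_of_limsup_eq_top {m : ℕ → ℕ} (hm : ∀ k, 2 ≤ m k) {B : ℕ}
    (hB : ∀ k, m k ≤ B) {φ : ℕ → ℝ} (hφ1 : ∀ n, 1 ≤ n → 1 ≤ φ n) (hφ : MonotoneOn φ (Set.Ici 1))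
    (hlim : limsup (fun n : ℕ => ((Real.log n / φ n : ℝ) : EReal)) atTop = ⊤) (C : ℝ) :
    ∃ᶠ i : ℕ in atTop, C < (i - 1 : ℝ) / φ (2 * genM m i) := by
  rw [frequently_atTop]
  intro A
  have hB2 : (2 : ℝ) ≤ B := by exact_mod_cast (hm 0).trans (hB 0)
  have hlogB : 0 < Real.log B := Real.log_pos (by linarith)
  -- The extra `3` absorbs the gap between `i + 2` and `i - 1`, as `φ n ≥ 1`.
  have hfreq := frequently_lt_of_lt_limsup (f := atTop)
    (u := fun n : ℕ => ((Real.log n / φ n : ℝ) : EReal))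
    (b := (((|C| + 3) * Real.log B : ℝ) : EReal)) (by isBoundedDefault)
    (by rw [hlim]; exact EReal.coe_lt_top _)
  obtain ⟨n, hn, hlt⟩ := frequently_atTop.1 hfreq (genM m (A + 1))
  have hn1 : 1 ≤ n := (genM_pos hm _).trans_le hn
  have hφn := hφ1 n hn1
  rw [EReal.coe_lt_coe_iff, lt_div_iff₀ (by linarith)] at hlt
  obtain ⟨i, hAi, hi, hi'⟩ : ∃ i, A ≤ i ∧ genM m (i + 1) ≤ n ∧ n < genM m (i + 2) := by
    have hex : ∃ k, n < genM m k := ⟨n, lt_genM hm n⟩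
    have hgt : A + 1 < Nat.find hex := by
      by_contra! hle
      exact absurd ((Nat.find_spec hex).trans_le (genM_mono hm hle)) (not_lt.2 hn)
    obtain ⟨i, hi⟩ : ∃ i, Nat.find hex = i + 2 := ⟨Nat.find hex - 2, by omega⟩
    exact ⟨i, by omega, not_lt.1 (Nat.find_min hex (by omega)), hi ▸ Nat.find_spec hex⟩
  refine ⟨i, hAi, ?_⟩
  have h2 : 2 * genM m i ≤ n := (two_mul_genM_le hm i).trans hi
  have hone : 1 ≤ 2 * genM m i := by have := genM_pos hm i; omega
  have hφle := hφ hone hn1 h2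
  have hφ0 := hφ1 _ hone
  have hlogn : Real.log n ≤ (i + 2) * Real.log B := by
    have : (n : ℝ) ≤ (B : ℝ) ^ (i + 2) := by exact_mod_cast hi'.le.trans (genM_le_pow hB _)
    have := Real.log_le_log (by exact_mod_cast hn1) this
    rw [Real.log_pow] at this
    exact_mod_cast this
  have h3 : (|C| + 3) * φ n < i + 2 := by
    refine lt_of_mul_lt_mul_right ?_ hlogB.le
    linarith
  have h4 : |C| * φ n < i - 1 := by linarith
  rw [lt_div_iff₀ (by linarith)]
  calc C * φ (2 * genM m i) ≤ |C| * φ n := by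
        gcongr
        exact le_abs_self C
    _ < _ := h4

/-! ### Divergence for the series of atoms. -/

section

variable {m : ℕ → ℕ} [∀ k, NeZero (m k)]

theorem integrable_partialSum (hm : ∀ k, 2 ≤ m k) (f : ℕ → VilenkinGroup m → ℂ) (n : ℕ) :
    Integrable (partialSum f n) (haar m) :=
  integrable_finsetSum _ fun k _ => (integrable_of_norm_le (measurable_psi hm k)
    fun x => (norm_psi k x).le).const_mul _

theorem integral_norm_atomSum_le (hm : ∀ k, 2 ≤ m k) {c : ℕ → ℝ} (hc0 : ∀ i, 0 ≤ c i)
    (hc : Summable c) (n : ℕ) : ∫ x, ‖atomSum m c n x‖ ∂(haar m) ≤ 2 * ∑' i, c i := by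
  calc ∫ x, ‖atomSum m c n x‖ ∂(haar m)
      ≤ ∫ x, ∑ i ∈ Finset.range n, ‖c i * atom m i x‖ ∂(haar m) :=
        integral_mono (integrable_atomSum hm c n).norm
          (integrable_finsetSum _ fun i _ => (integrable_mul_atom hm c i).norm)
          fun x => norm_sum_le _ _
    _ = ∑ i ∈ Finset.range n, ∫ x, ‖c i * atom m i x‖ ∂(haar m) :=
        integral_finsetSum _ fun i _ => (integrable_mul_atom hm c i).norm
    _ ≤ ∑ i ∈ Finset.range n, c i * 2 :=
        Finset.sum_le_sum fun i _ => integral_norm_mul_atom_le hm hc0 i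
    _ ≤ 2 * ∑' i, c i := by
        rw [← Finset.sum_mul, mul_comm]
        exact mul_le_mul_of_nonneg_left (hc.sum_le_tsum _ fun i _ => hc0 i) two_pos.le

theorem le_integral_norm_partialSum_atomSeries (hm : ∀ k, 2 ≤ m k) {c : ℕ → ℝ}
    (hc0 : ∀ i, 0 ≤ c i) (hc : Summable c) {α k : ℕ} (hk : k < genM m α) :
    c α * ∫ x, ‖dirichlet m k x‖ ∂(haar m) - 2 * ∑' i, c i ≤
      ∫ x, ‖partialSum (regularMartingale (atomSeries m c)) (genM m α + k) x‖ ∂(haar m) := by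
  refine le_trans (sub_le_sub_left (integral_norm_atomSum_le hm hc0 hc α) _) ?_
  have hD := (integrable_dirichlet hm k).norm.const_mul (c α)
  have hA := (integrable_atomSum hm c α).norm
  rw [← integral_const_mul, ← integral_sub hD hA]
  refine integral_mono (hD.sub hA) (integrable_partialSum hm _ _).norm fun x => ?_
  dsimp only
  rw [partialSum_atomSeries hm hc0 hc hk, add_comm]
  have h : c α * ‖dirichlet m k x‖ = ‖c α * (rademacher m α x * dirichlet m k x)‖ := by
    rw [norm_mul, norm_mul, norm_rademacher, one_mul, Complex.norm_real,
      Real.norm_of_nonneg (hc0 α)]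
  rw [h]
  exact norm_sub_le_norm_add _ _

/-- Keeps only the indices in `[M_α, 2M_α)`, where the term `c_α r_α D_k` is visible, and averages
the lower bound over `k < M_α`. -/
theorem le_of_sumNorms_atomSeries_le (hm : ∀ k, 2 ≤ m k) {B : ℕ} (hB : ∀ k, m k ≤ B) {c : ℕ → ℝ}
    (hc0 : ∀ i, 0 ≤ c i) (hc : Summable c) {α : ℕ} {K : ℝ} (hK : 0 ≤ K)
    (h : sumNorms (regularMartingale (atomSeries m c)) (2 * genM m α) ≤ ENNReal.ofReal K) :
    c α * (genM m α * ((α - 1 : ℝ) / (8 * B))) ≤ K + genM m α * (2 * ∑' i, c i) := by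
  set f := regularMartingale (atomSeries m c) with hf
  have h1 : ∑ k ∈ Finset.range (genM m α), ∫ x, ‖partialSum f (genM m α + k) x‖ ∂(haar m) ≤ K := by
    rw [← ENNReal.ofReal_le_ofReal_iff hK,
      ENNReal.ofReal_sum_of_nonneg fun k _ => integral_nonneg fun x => norm_nonneg _]
    refine le_trans ?_ h
    simp only [ofReal_integral_norm_eq_lintegral_enorm (integrable_partialSum hm f _),
      ← eLpNorm_one_eq_lintegral_enorm]
    have h2 := Finset.sum_Ico_eq_sum_range (fun k => eLpNorm (partialSum f k) 1 (haar m))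
      (genM m α) (2 * genM m α)
    rw [show 2 * genM m α - genM m α = genM m α by omega] at h2
    rw [← h2, sumNorms]
    refine Finset.sum_le_sum_of_subset fun k hk => ?_
    have hpos := genM_pos hm α
    rw [Finset.mem_Ico] at hk
    rw [Finset.mem_Icc]
    omega
  have h2 := Finset.sum_le_sum fun k hk =>
    le_integral_norm_partialSum_atomSeries hm hc0 hc (α := α) (Finset.mem_range.1 hk)
  rw [Finset.sum_sub_distrib, ← Finset.mul_sum, Finset.sum_const, Finset.card_range,
    nsmul_eq_mul] at h2
  have h3 := mul_le_mul_of_nonneg_left (sum_integral_norm_dirichlet_ge hm hB α) (hc0 α)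
  linarith

/-- The logarithmic factor in the bound for the means of the `L_1`-norms of partial sums is sharp
on the martingale Hardy space of a bounded Vilenkin group. -/
theorem exists_memHardy_iSup_sumNorms_eq_top (hm : ∀ k, 2 ≤ m k) (hbdd : BddAbove (Set.range m))
    {φ : ℕ → ℝ} (hφ1 : ∀ n, 1 ≤ n → 1 ≤ φ n) (hφ : MonotoneOn φ (Set.Ici 1))
    (hlim : limsup (fun n : ℕ => ((Real.log n / φ n : ℝ) : EReal)) atTop = ⊤) :
    ∃ g : VilenkinGroup m → ℂ, Integrable g (haar m) ∧ MemHardy (regularMartingale g) ∧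
      (⨆ n : ℕ, ⨆ _ : 1 ≤ n, sumNorms (regularMartingale g) n /
        ENNReal.ofReal (n * φ n) : ℝ≥0∞) = ∞ := by
  obtain ⟨B, hB⟩ := hbdd
  have hB : ∀ k, m k ≤ B := fun k => hB ⟨k, rfl⟩
  have hB0 : (0 : ℝ) < B := by exact_mod_cast (NeZero.pos (m 0)).trans_le (hB 0)
  obtain ⟨c, hc0, hc, hunb⟩ := exists_summable_mul_unbounded
    (frequently_lt_div_of_limsup_eq_top hm hB hφ1 hφ hlim)
  refine ⟨atomSeries m c, integrable_atomSeries hm hc0 hc, memHardy_atomSeries hm hc0 hc, ?_⟩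
  by_contra hne
  set S := (⨆ n : ℕ, ⨆ _ : 1 ≤ n, sumNorms (regularMartingale (atomSeries m c)) n /
    ENNReal.ofReal (n * φ n) : ℝ≥0∞) with hS
  have hΛ : 0 ≤ ∑' i, c i := tsum_nonneg hc0
  -- A finite supremum `S` would bound the sum up to `2M_α` by `2 S M_α φ(2M_α)`. Dividing by `M_α
  -- φ(2M_α)` bounds `c_α (α-1)/φ(2M_α)` by exactly this threshold.
  obtain ⟨α, hα⟩ := hunb (8 * B * (2 * S.toReal + 2 * ∑' i, c i))
  have hM : (0 : ℝ) < genM m α := by exact_mod_cast genM_pos hm α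
  have hone : 1 ≤ 2 * genM m α := by have := genM_pos hm α; omega
  have hφ0 := hφ1 _ hone
  have hpos : (0 : ℝ) < (2 * genM m α : ℕ) * φ (2 * genM m α) :=
    mul_pos (by exact_mod_cast hone) (by linarith)
  have h1 : sumNorms (regularMartingale (atomSeries m c)) (2 * genM m α) ≤
      ENNReal.ofReal (S.toReal * ((2 * genM m α : ℕ) * φ (2 * genM m α))) := by
    have h : sumNorms (regularMartingale (atomSeries m c)) (2 * genM m α) /
        ENNReal.ofReal ((2 * genM m α : ℕ) * φ (2 * genM m α)) ≤ S :=
      le_iSup₂_of_le (2 * genM m α) hone le_rfl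
    rw [ENNReal.div_le_iff (ENNReal.ofReal_pos.2 hpos).ne' ENNReal.ofReal_ne_top] at h
    rwa [ENNReal.ofReal_mul ENNReal.toReal_nonneg, ENNReal.ofReal_toReal hne]
  have h2 := le_of_sumNorms_atomSeries_le hm hB hc0 hc (by positivity) h1
  rw [← mul_div_assoc, lt_div_iff₀ (by linarith)] at hα
  have h3 : c α * (genM m α * ((α - 1 : ℝ) / (8 * B))) =
      genM m α * ((c α * (α - 1 : ℝ)) / (8 * B)) := by ring
  have h4 : S.toReal * ((2 * genM m α : ℕ) * φ (2 * genM m α)) +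
      genM m α * (2 * ∑' i, c i) ≤
      genM m α * ((2 * S.toReal + 2 * ∑' i, c i) * φ (2 * genM m α)) := by
    have h5 : ∑' i, c i ≤ (∑' i, c i) * φ (2 * genM m α) := le_mul_of_one_le_right hΛ hφ0
    push_cast
    nlinarith
  rw [h3] at h2
  have h6 := le_of_mul_le_mul_left (h2.trans h4) hM
  rw [div_le_iff₀ (by positivity)] at h6
  linarith

end

end Vilenkin

theorem mainTheorem9 :
    (∃ c : ℝ≥0, ∀ (m : ℕ → ℕ) [∀ k, NeZero (m k)], (∀ k, 2 ≤ m k) → BddAbove (Set.range m) →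
      ∀ f : ℕ → Vilenkin.VilenkinGroup m → ℂ, Vilenkin.MemHardy f →
        (⨆ n : ℕ, ⨆ _ : 2 ≤ n, Vilenkin.sumNorms f n / ENNReal.ofReal (n * Real.log n) : ℝ≥0∞)
          ≤ c * Vilenkin.hardyNorm f) ∧
    (∀ (m : ℕ → ℕ) [∀ k, NeZero (m k)], (∀ k, 2 ≤ m k) → BddAbove (Set.range m) →
      ∀ φ : ℕ → ℝ, (∀ n, 1 ≤ n → 1 ≤ φ n) → MonotoneOn φ (Set.Ici 1) →
        limsup (fun n : ℕ => ((Real.log n / φ n : ℝ) : EReal)) atTop = ⊤ →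
        ∃ g : Vilenkin.VilenkinGroup m → ℂ, Integrable g (Vilenkin.haar m) ∧
          Vilenkin.MemHardy (Vilenkin.regularMartingale g) ∧
          (⨆ n : ℕ, ⨆ _ : 1 ≤ n, Vilenkin.sumNorms (Vilenkin.regularMartingale g) n /
            ENNReal.ofReal (n * φ n) : ℝ≥0∞) = ∞) ∧
    (∀ (m : ℕ → ℕ) [∀ k, NeZero (m k)], (∀ k, 2 ≤ m k) → BddAbove (Set.range m) →
      ∃ g : Vilenkin.VilenkinGroup m → ℂ, Integrable g (Vilenkin.haar m) ∧
        Vilenkin.MemHardy (Vilenkin.regularMartingale g) ∧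
        (⨆ n : ℕ, ⨆ _ : 1 ≤ n, Vilenkin.sumNorms (Vilenkin.regularMartingale g) n /
          (n : ℝ≥0∞) : ℝ≥0∞) = ∞) := by
  refine ⟨⟨12, ?_⟩, ?_, ?_⟩
  · intro m _ hm _ f hf
    refine iSup₂_le fun n hn => ENNReal.div_le_of_le_mul ?_
    simpa using Vilenkin.sumNorms_le hm hf.1 hn
  · intro m _ hm hbdd φ hφ1 hφ hlim
    exact Vilenkin.exists_memHardy_iSup_sumNorms_eq_top hm hbdd hφ1 hφ hlim
  · intro m _ hm hbdd
    have hlim : limsup (fun n : ℕ => ((Real.log n / (1 : ℝ) : ℝ) : EReal)) atTop = ⊤ := by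
      refine Tendsto.limsup_eq ?_
      simp only [div_one]
      rw [EReal.tendsto_coe_nhds_top_iff]
      exact Real.tendsto_log_atTop.comp tendsto_natCast_atTop_atTop
    have h := Vilenkin.exists_memHardy_iSup_sumNorms_eq_top (φ := fun _ => 1) hm hbdd
      (fun _ _ => le_rfl) monotoneOn_const hlim
    simpa only [mul_one, ENNReal.ofReal_natCast] using h
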